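/- **Theorem 4.14.** Let $X$ be a non-empty compact Hausdorff space and let $A\subseteq C(X)$ be a uniform algebra on $X$ (a uniformly closed subalgebra of the complex continuous functions that contains the constants and separates the points of $X$). Suppose that $A$ is natural, i.e. every character (non-zero algebra homomorphism $A\to\mathbb C$) is evaluation at a point of $X$. Let $\alpha(x)=a_0+\dots+a_{n-1}x^{n-1}+x^n\in A[x]$ be monic, and let $d=\mathrm{discr}(\alpha)\in A$ be its discriminant. Let $B=A[x]/(\alpha(x))$ be the Arens–Hoffman extension of $A$, with an Arens–Hoffman norm, i.e. the quotient norm of $\bigl\|\sum_k c_kx^k\bigr\|=\sum_k\|c_k\|_\infty t^k$ for some $t>0$ with $\sum_{k<n}\|a_k\|_\infty t^k\le t^n$, and let $K(B)$ be the intersection of the closed maximal ideals of $B$. Let $A^\alpha$ be the simple Cole extension of $A$: the closed subalgebra of $C(X^\alpha)$, where $$X^\alpha=\{(\kappa,\lambda)\in X\times\mathbb C:\ a_0(\kappa)+\dots+a_{n-1}(\kappa)\lambda^{n-1}+\lambda^n=0\},$$ generated by the functions $(\kappa,\lambda)\mapsto f(\kappa)$ $(f\in A)$ and $(\kappa,\lambda)\mapsto\lambda$.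 Suppose that $d$ is a topological divisor of zero in $A$ (there are $u_m\in A$ with $\|u_m\|_\infty=1$ for all $m$ and $u_md\to0$), but that $d\neq0$ and $d$ is not a zero divisor in $A$. Then, for every admissible $t$, there is no isomorphism of complex algebras (continuous or not) from $B/K(B)$ onto $A^\alpha$. For example, let $A_\Delta$ be the disc algebra (the continuous functions on the closed unit disc $\Delta$ that are holomorphic in the interior), let $z$ be the coordinate function, and let $\alpha(x)=x^2-(z-1)\in A_\Delta[x]$. Then $A_\Delta$ is a natural uniform algebra on $\Delta$, and $\mathrm{discr}(\alpha)=4(z-1)$ is a topological divisor of zero but neither zero nor a zero divisor. Admissible parameters $t$ exist, and for every one of them there is no algebra isomorphism from $B/K(B)$ onto $(A_\Delta)^\alpha$. This is a counterexample to the Cole–Feinstein conjecture that $B/K(B)$ and $A^\alpha$ are always isomorphic. -/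

import Mathlib

open Polynomial Topology Filter

noncomputable section

namespace ColeExt

section UniformAlgebra

variable {X : Type*} [TopologicalSpace X] [CompactSpace X] [T2Space X]

/-- `A ⊆ C(X)` is a uniform algebra on the compact Hausdorff space `X`: it separates the points of `X` and is
uniformly closed.  (It contains the constants, being a unital subalgebra.) -/
structure IsUniformAlgebra (A : Subalgebra ℂ C(X, ℂ)) : Prop where
  separatesPoints : A.SeparatesPoints
  isClosed : IsClosed (A : Set C(X, ℂ))

/-- Evaluation at the point `κ` of `X`, as a character of `A`. -/
def evalAt (A : Subalgebra ℂ C(X, ℂ)) (κ : X) : A →ₐ[ℂ] ℂ :=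
  (ContinuousMap.evalAlgHom ℂ ℂ κ).comp A.val

/-- `A` is natural on `X`: every character (nonzero complex homomorphism) of `A` is the evaluation
at a point of `X`. -/
def IsNatural (A : Subalgebra ℂ C(X, ℂ)) : Prop :=
  Function.Surjective (evalAt A)

/-- The compact space `{(κ, z) ∈ X × ℂ : α(κ)(z) = 0}` of the simple Cole extension by `α`. -/
def coleSpace {A : Subalgebra ℂ C(X, ℂ)} (α : A[X]) : Set (X × ℂ) :=
  {p | eval₂ (evalAt A p.1 : A →+* ℂ) p.2 α = 0}

theorem continuous_eval_prod {A : Subalgebra ℂ C(X, ℂ)} (α : A[X]) :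
    Continuous fun p : X × ℂ => eval₂ (evalAt A p.1 : A →+* ℂ) p.2 α := by
  simp only [eval₂_eq_sum_range]
  refine continuous_finsetSum _ fun i _ => ?_
  exact (((α.coeff i : C(X, ℂ)).continuous.comp continuous_fst)).mul (continuous_snd.pow i)

theorem isClosed_coleSpace {A : Subalgebra ℂ C(X, ℂ)} (α : A[X]) : IsClosed (coleSpace α) :=
  isClosed_eq (continuous_eval_prod α) continuous_const

instance {A : Subalgebra ℂ C(X, ℂ)} (α : A[X]) : LocallyCompactSpace (coleSpace α) :=
  (isClosed_coleSpace α).isClosedEmbedding_subtypeVal.locallyCompactSpace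

/-- For monic `α` the space `coleSpace α` is compact. -/
theorem compactSpace_coleSpace {A : Subalgebra ℂ C(X, ℂ)} {α : A[X]} (hα : α.Monic) :
    CompactSpace (coleSpace α) := by
  set M : ℝ := 1 + ∑ i ∈ Finset.range α.natDegree, ‖(α.coeff i : C(X, ℂ))‖ with hM
  refine isCompact_iff_compactSpace.mp <|
    (isCompact_univ.prod (isCompact_closedBall (0 : ℂ) M)).of_isClosed_subset
      (isClosed_coleSpace α) ?_
  rintro ⟨κ, z⟩ h
  refine ⟨trivial, ?_⟩
  rw [mem_closedBall_zero_iff]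
  by_contra! hz
  have hnn : ∀ i ∈ Finset.range α.natDegree, 0 ≤ ‖(α.coeff i : C(X, ℂ))‖ :=
    fun _ _ => norm_nonneg _
  have h1 : (1 : ℝ) ≤ ‖z‖ := by linarith [Finset.sum_nonneg hnn]
  have hp : (0 : ℝ) < ‖z‖ := by linarith
  have h0 : eval₂ (evalAt A κ : A →+* ℂ) z α = 0 := h
  rw [eval₂_eq_sum_range, Finset.sum_range_succ, hα.coeff_natDegree, map_one, one_mul] at h0
  rcases Nat.eq_zero_or_pos α.natDegree with hn | hn
  · simp [hn] at h0
  have h2 : ‖z‖ ^ α.natDegree ≤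
      ∑ i ∈ Finset.range α.natDegree, ‖(α.coeff i : C(X, ℂ))‖ * ‖z‖ ^ (α.natDegree - 1) := by
    rw [← norm_pow, eq_neg_of_add_eq_zero_right h0, norm_neg]
    refine (norm_sum_le _ _).trans (Finset.sum_le_sum fun i hi => ?_)
    rw [norm_mul, norm_pow]
    have := Finset.mem_range.mp hi
    exact mul_le_mul (ContinuousMap.norm_coe_le_norm (α.coeff i : C(X, ℂ)) κ)
      (pow_le_pow_right₀ h1 (by lia)) (by positivity) (norm_nonneg _)
  rw [← Finset.sum_mul] at h2
  obtain ⟨m, hm⟩ : ∃ m, α.natDegree = m + 1 := ⟨α.natDegree - 1, by lia⟩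
  have h3 : ‖z‖ * ‖z‖ ^ (α.natDegree - 1) = ‖z‖ ^ α.natDegree := by
    rw [hm, Nat.add_sub_cancel, pow_succ']
  rw [← h3] at h2
  have h4 := le_of_mul_le_mul_right h2 (pow_pos hp _)
  linarith

/-- The projection `coleSpace α → X`. -/
def coleProj {A : Subalgebra ℂ C(X, ℂ)} (α : A[X]) : C(coleSpace α, X) :=
  ⟨fun p => p.1.1, continuous_fst.comp continuous_subtype_val⟩

/-- The coordinate function `(κ, z) ↦ z` on `coleSpace α`. -/
def coleRoot {A : Subalgebra ℂ C(X, ℂ)} (α : A[X]) : C(coleSpace α, ℂ) :=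
  ⟨fun p => p.1.2, continuous_snd.comp continuous_subtype_val⟩

/-- The simple Cole extension: the closed subalgebra of `C(coleSpace α)` generated by the functions
`f ∘ coleProj α`, `f ∈ A`, and the function `coleRoot α`.  (For monic `α` the space `coleSpace α` is
compact, so that the compact-open topology used here is that of uniform convergence.) -/
def coleExtension {A : Subalgebra ℂ C(X, ℂ)} (α : A[X]) : Subalgebra ℂ C(coleSpace α, ℂ) :=
  (Algebra.adjoin ℂ
    (Set.range (fun f : A => (f : C(X, ℂ)).comp (coleProj α)) ∪ {coleRoot α})).topologicalClosure

end UniformAlgebra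

section ArensHoffman

variable {R : Type*} [NormedCommRing R]

/-- `a` is a topological divisor of zero. -/
def IsTopologicalDivisorOfZero (a : R) : Prop :=
  ∃ u : ℕ → R, (∀ n, ‖u n‖ = 1) ∧ Tendsto (fun n => u n * a) atTop (𝓝 0)

/-- `t` is an admissible parameter for an Arens–Hoffman norm:
`t > 0` and `‖a₀‖ + ‖a₁‖ t + ⋯ + ‖aₙ₋₁‖ tⁿ⁻¹ ≤ tⁿ`, where `n` is the degree of `α`. -/
def IsAHParameter (α : R[X]) (t : ℝ) : Prop :=
  0 < t ∧ ∑ k ∈ Finset.range α.natDegree, ‖α.coeff k‖ * t ^ k ≤ t ^ α.natDegree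

/-- The norm `∑ ‖cₖ‖ tᵏ` of the polynomial `∑ cₖ xᵏ`. -/
def polyNorm (t : ℝ) (γ : R[X]) : ℝ :=
  γ.sum fun k c => ‖c‖ * t ^ k

/-- The Arens–Hoffman norm with parameter `t` on `B = R[x]/(α)`: the quotient norm of `polyNorm`. -/
def ahNorm (α : R[X]) (t : ℝ) (b : AdjoinRoot α) : ℝ :=
  sInf (polyNorm t '' {γ : R[X] | AdjoinRoot.mk α γ = b})

/-- `S ⊆ B` is closed for the Arens–Hoffman norm. -/
def IsAHClosed (α : R[X]) (t : ℝ) (S : Set (AdjoinRoot α)) : Prop :=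
  ∀ b, (∀ ε : ℝ, 0 < ε → ∃ s ∈ S, ahNorm α t (b - s) < ε) → b ∈ S

/-- `K(B)`: the intersection of the closed maximal ideals of the Arens–Hoffman extension
`B = R[x]/(α)`, normed with parameter `t`. -/
def ahRadical (α : R[X]) (t : ℝ) : Ideal (AdjoinRoot α) :=
  sInf {M : Ideal (AdjoinRoot α) | M.IsMaximal ∧ IsAHClosed α t (M : Set (AdjoinRoot α))}

end ArensHoffman

section DiscAlgebra

/-- The closed unit disc of `ℂ`. -/
abbrev ClosedDisc : Type := Metric.closedBall (0 : ℂ) 1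

/-- The disc algebra: the continuous functions on the closed unit disc that are holomorphic on the
open unit disc. -/
def discAlgebra : Subalgebra ℂ C(ClosedDisc, ℂ) where
  carrier := {f | ∃ g : ℂ → ℂ, DifferentiableOn ℂ g (Metric.ball 0 1) ∧
    ∀ z : ClosedDisc, (z : ℂ) ∈ Metric.ball (0 : ℂ) 1 → f z = g z}
  mul_mem' := by
    rintro f₁ f₂ ⟨g₁, h₁, e₁⟩ ⟨g₂, h₂, e₂⟩
    exact ⟨g₁ * g₂, h₁.mul h₂, fun z hz => by simp [e₁ z hz, e₂ z hz]⟩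
  add_mem' := by
    rintro f₁ f₂ ⟨g₁, h₁, e₁⟩ ⟨g₂, h₂, e₂⟩
    exact ⟨g₁ + g₂, h₁.add h₂, fun z hz => by simp [e₁ z hz, e₂ z hz]⟩
  algebraMap_mem' c := ⟨fun _ => c, differentiableOn_const c, fun _ _ => rfl⟩

/-- The coordinate function `z` of the disc algebra. -/
def discCoord : discAlgebra :=
  ⟨⟨fun z => (z : ℂ), continuous_subtype_val⟩, fun z => z, differentiableOn_id, fun _ _ => rfl⟩

/-- The polynomial `x² - (z - 1)` over the disc algebra. -/
def discPoly : discAlgebra[X] :=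
  X ^ 2 - C (discCoord - 1)

end DiscAlgebra

end ColeExt

end

/-!
Let `B = A[x]/(α)`, and write `rootEval p` for the character of `B` at a point `p = (κ, λ)` of
`coleSpace α`, and `coords` for the coordinates of `B` in the basis `1, x, …, xⁿ⁻¹`.

*Semisimplicity.* If `discr α` is not a zero divisor, then the `rootEval p` are jointly injective:
where the discriminant is nonzero, a polynomial of degree `< n` vanishing at all the roots of `α` is
zero (`eq_zero_of_rootEval_eq_zero`).  Each `rootEval p` is contractive for every Arens–Hoffman
norm, so its kernel is a closed maximal ideal, and therefore `K(B) = 0` (`ahRadical_eq_bot`).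

*Automatic continuity.* Let `Θ` be an algebra isomorphism of `B` onto the Cole extension, a Banach
algebra in the supremum norm.  By the closed graph theorem `coords ∘ Θ⁻¹` is continuous; by
naturality of `A` every character of `B` is some `rootEval p`, so `Θ` does not increase the
supremum norm over `coleSpace α`.  Hence that norm dominates the coordinates
(`exists_coords_bound`).

*Contradiction.* Since `discr α` is a topological divisor of zero, it has a zero `κ` at which `A`
peaks, as far as the coefficients of `α` can see (`exists_peaking_zero`, a form of the statement
that a topological divisor of zero vanishes somewhere on the Shilov boundary).  Over `κ` there are
fewer than `n` distinct roots; let `q` be the monic complex polynomial having these as simple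
roots.  For `f` peaking at `κ`, the element `f · q` of `B` is uniformly small on `coleSpace α`,
although its coordinate `f` has norm `1` (`isEmpty_algEquiv_coleExtension`).

*The disc algebra.* A character `φ` with `φ z = w` sends `g` to `g w` when `g` is holomorphic near
the closed disc, because `g - g w` is divisible by `z - w`; dilation and continuity extend this to
the whole algebra (`isNatural_discAlgebra`).  The functions `((1 + z) / 2) ^ m` show that
`4 (z - 1)` is a topological divisor of zero.
-/

noncomputable section

namespace ColeExt

/-! ### Discriminants and separability -/

/-- Discriminants of monic polynomials commute with base change to a field of characteristic zero,
and there they detect separability. -/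
theorem map_discr_ne_zero_iff {R K : Type*} [CommRing R] [Field K] [CharZero K] (φ : R →+* K)
    {α : R[X]} (hα : α.Monic) : φ α.discr ≠ 0 ↔ (α.map φ).Separable := by
  rcases Nat.eq_zero_or_pos α.natDegree with hn | hn
  · have h1 : α = C 1 := by rw [C_1]; exact hα.natDegree_eq_zero.mp hn
    rw [h1, discr_C]
    simp [separable_one]
  · have h := congrArg φ (resultant_deriv (natDegree_pos_iff_degree_pos.mp hn))
    rw [← resultant_map_map, hα.leadingCoeff, mul_one, map_mul, ← derivative_map] at h
    have hd : (α.map φ).natDegree = α.natDegree := hα.natDegree_map φ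
    have h' : (α.map φ).resultant (derivative (α.map φ)) ≠ 0 ↔ φ α.discr ≠ 0 := by
      rw [natDegree_derivative, hd, h]
      simp
    rw [← h', Ne, resultant_eq_zero_iff]
    simp [Polynomial.Separable, (hα.map φ).ne_zero]

/-- The zeros of a monic complex polynomial with a repeated root are also zeros of a monic
polynomial of lower degree, the product over the distinct roots. -/
theorem exists_monic_natDegree_lt_of_not_separable {P : ℂ[X]} (hP : P.Monic)
    (h : ¬ P.Separable) :
    ∃ q : ℂ[X], q.Monic ∧ q.natDegree < P.natDegree ∧ ∀ z, P.eval z = 0 → q.eval z = 0 := by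
  have hs : P.Splits := IsAlgClosed.splits P
  rw [← nodup_roots_iff_of_splits hP.ne_zero hs, ← Multiset.toFinset_card_eq_card_iff_nodup,
    ← hs.natDegree_eq_card_roots] at h
  refine ⟨∏ r ∈ P.roots.toFinset, (X - C r), monic_prod_of_monic _ _ fun r _ => monic_X_sub_C r,
    ?_, fun z hz => ?_⟩
  · rw [natDegree_prod_of_monic _ _ fun r _ => monic_X_sub_C r]
    simp only [natDegree_X_sub_C, Finset.sum_const, smul_eq_mul, mul_one]
    refine lt_of_le_of_ne ?_ h
    rw [hs.natDegree_eq_card_roots]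
    exact P.roots.toFinset_card_le
  · rw [eval_prod]
    exact Finset.prod_eq_zero (i := z) (by simp [hP.ne_zero, hz]) (by simp)

/-- A polynomial of degree less than `deg P` that vanishes at all roots of a separable `P` is
zero. -/
theorem eq_zero_of_vanishes_on_roots {P g : ℂ[X]} (hP : P.Separable)
    (hg : g.degree < P.natDegree) (h : ∀ z, P.eval z = 0 → g.eval z = 0) : g = 0 := by
  have hs : P.Splits := IsAlgClosed.splits P
  refine eq_zero_of_degree_lt_of_eval_finset_eq_zero P.roots.toFinset ?_ fun z hz => h z ?_
  · rwa [Multiset.toFinset_card_of_nodup (nodup_roots hP), ← hs.natDegree_eq_card_roots]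
  · exact (mem_roots'.mp (Multiset.mem_toFinset.mp hz)).2

/-! ### The Gelfand transform of the Arens–Hoffman extension -/

section

variable {X : Type*} [TopologicalSpace X] {A : Subalgebra ℂ C(X, ℂ)} {α : A[X]}

theorem norm_pow_apply (f : A) (k : ℕ) (x : X) :
    ‖((f ^ k : A) : C(X, ℂ)) x‖ = ‖(f : C(X, ℂ)) x‖ ^ k :=
  norm_pow ((f : C(X, ℂ)) x) k

theorem norm_mul_apply (f g : A) (x : X) :
    ‖((f * g : A) : C(X, ℂ)) x‖ = ‖(f : C(X, ℂ)) x‖ * ‖(g : C(X, ℂ)) x‖ :=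
  norm_mul ((f : C(X, ℂ)) x) ((g : C(X, ℂ)) x)

theorem isClosed_exists_le_norm_sub {ι : Type*} [Finite ι] (F : ι → A) (κ : X) (η : ℝ) :
    IsClosed {x | ∃ i, η ≤ ‖(F i : C(X, ℂ)) x - (F i : C(X, ℂ)) κ‖} := by
  have : {x | ∃ i, η ≤ ‖(F i : C(X, ℂ)) x - (F i : C(X, ℂ)) κ‖} =
      ⋃ i, {x | η ≤ ‖(F i : C(X, ℂ)) x - (F i : C(X, ℂ)) κ‖} := by ext x; simp
  rw [this]
  exact isClosed_iUnion_of_finite fun i => isClosed_le continuous_const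
    (((F i : C(X, ℂ)).continuous.sub continuous_const).norm)

theorem mem_coleSpace_iff (κ : X) (z : ℂ) :
    (κ, z) ∈ coleSpace α ↔ (α.map (evalAt A κ : A →+* ℂ)).eval z = 0 := by
  rw [eval_map]; rfl

variable [CompactSpace X]

/-- The character `∑ cₖ xᵏ ↦ ∑ cₖ(κ) λᵏ` of `A[x]/(α)` at the point `(κ, λ)` of `coleSpace α`. -/
def rootEval (p : coleSpace α) : AdjoinRoot α →ₐ[ℂ] ℂ :=
  AdjoinRoot.liftAlgHom α (evalAt A p.1.1) p.1.2 p.2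

theorem rootEval_mk (p : coleSpace α) (g : A[X]) :
    rootEval p (AdjoinRoot.mk α g) = eval₂ (evalAt A p.1.1 : A →+* ℂ) p.1.2 g :=
  AdjoinRoot.liftAlgHom_mk ..

/-- For monic `α` of degree `n`, the coordinates of an element of `A[x]/(α)` in the basis
`1, x, …, xⁿ⁻¹`. -/
def coords (hα : α.Monic) : AdjoinRoot α ≃ₗ[A] (Fin α.natDegree → A) :=
  (AdjoinRoot.powerBasisAux' hα).equivFun

theorem coords_apply (hα : α.Monic) (b : AdjoinRoot α) (i : Fin α.natDegree) :
    coords hα b i = (AdjoinRoot.modByMonicHom hα b).coeff i :=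
  AdjoinRoot.powerBasisAux'_repr_apply_to_fun hα b i

theorem coords_mk [Nonempty X] (hα : α.Monic) {g : A[X]} (hg : g.natDegree < α.natDegree)
    (i : Fin α.natDegree) : coords hα (AdjoinRoot.mk α g) i = g.coeff i := by
  rw [coords_apply, AdjoinRoot.modByMonicHom_mk,
    (modByMonic_eq_self_iff hα).mpr (degree_lt_degree hg)]

theorem degree_modByMonicHom_lt [Nonempty X] (hα : α.Monic) (b : AdjoinRoot α) :
    (AdjoinRoot.modByMonicHom hα b).degree < α.natDegree := by
  obtain ⟨g, rfl⟩ := AdjoinRoot.mk_surjective b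
  rw [AdjoinRoot.modByMonicHom_mk, ← degree_eq_natDegree hα.ne_zero]
  exact degree_modByMonic_lt _ hα

theorem rootEval_eq_sum [Nonempty X] (hα : α.Monic) (p : coleSpace α) (b : AdjoinRoot α) :
    rootEval p b = ∑ i, (coords hα b i : C(X, ℂ)) p.1.1 * p.1.2 ^ (i : ℕ) := by
  have h := rootEval_mk p (AdjoinRoot.modByMonicHom hα b)
  rw [AdjoinRoot.mk_leftInverse hα b] at h
  rw [h, eval₂_def, ← sum_fin (fun i c => (evalAt A p.1.1 : A →+* ℂ) c * p.1.2 ^ i) (by simp)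
    (degree_modByMonicHom_lt hα b)]
  simp only [coords_apply]
  rfl

/-- If `discr α` is not a zero divisor, then `A[x]/(α)` is semisimple: where `discr α` does not
vanish, an element killed by all the characters is represented by a polynomial of degree `< n` with
`n` distinct roots. -/
theorem eq_zero_of_rootEval_eq_zero [Nonempty X] (hα : α.Monic)
    (hd : ∀ a : A, a * α.discr = 0 → a = 0) {b : AdjoinRoot α} (hb : ∀ p, rootEval p b = 0) :
    b = 0 := by
  set g := AdjoinRoot.modByMonicHom hα b with hg
  have hbg : AdjoinRoot.mk α g = b := AdjoinRoot.mk_leftInverse hα b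
  suffices h : g = 0 by rw [← hbg, h, map_zero]
  ext1 i
  rw [coeff_zero]
  refine hd _ (Subtype.ext (ContinuousMap.ext fun κ => ?_))
  change evalAt A κ (g.coeff i * α.discr) = 0
  rw [map_mul]
  by_cases h0 : evalAt A κ α.discr = 0
  · rw [h0, mul_zero]
  have hs := (map_discr_ne_zero_iff (evalAt A κ : A →+* ℂ) hα).mp h0
  have hz : g.map (evalAt A κ : A →+* ℂ) = 0 := by
    refine eq_zero_of_vanishes_on_roots hs ?_ fun z hz => ?_
    · rw [hα.natDegree_map]
      exact degree_map_le.trans_lt (degree_modByMonicHom_lt hα b)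
    · have := hb ⟨(κ, z), (mem_coleSpace_iff κ z).mpr hz⟩
      rw [← hbg, rootEval_mk] at this
      rwa [eval_map]
  have : evalAt A κ (g.coeff i) = 0 := by
    simpa using congrArg (fun q => q.coeff i) hz
  rw [this, zero_mul]

/-- For a natural algebra `A`, the characters of `A[x]/(α)` are the points of `coleSpace α`. -/
theorem exists_eq_rootEval (hA : IsNatural A) (χ : AdjoinRoot α →ₐ[ℂ] ℂ) :
    ∃ p, χ = rootEval p := by
  obtain ⟨κ, hκ⟩ := hA (χ.comp (AdjoinRoot.ofAlgHom ℂ α))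
  have hmk : ∀ g, χ (AdjoinRoot.mk α g) =
      eval₂ (evalAt A κ : A →+* ℂ) (χ (AdjoinRoot.root α)) g := by
    intro g
    rw [hκ]
    induction g using Polynomial.induction_on' with
    | add p q hp hq => rw [map_add, map_add, hp, hq, eval₂_add]
    | monomial k c =>
      rw [← C_mul_X_pow_eq_monomial, map_mul, map_mul, map_pow, map_pow, eval₂_mul, eval₂_C,
        eval₂_X_pow]
      rfl
  refine ⟨⟨(κ, χ (AdjoinRoot.root α)), ?_⟩, AlgHom.ext fun b => ?_⟩
  · rw [coleSpace, Set.mem_ofPred_eq, ← hmk, AdjoinRoot.mk_self, map_zero]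
  · obtain ⟨g, rfl⟩ := AdjoinRoot.mk_surjective b
    rw [hmk, rootEval_mk]

theorem norm_apply_le (f : A) (κ : X) : ‖(f : C(X, ℂ)) κ‖ ≤ ‖f‖ :=
  ContinuousMap.norm_coe_le_norm (f : C(X, ℂ)) κ

/-- An admissible Arens–Hoffman parameter bounds the roots of `α` at every point of `X`. -/
theorem norm_root_le (hα : α.Monic) {t : ℝ} (ht : IsAHParameter α t) (p : coleSpace α) :
    ‖p.1.2‖ ≤ t := by
  obtain ⟨⟨κ, z⟩, hp⟩ := p
  by_contra! hz
  change t < ‖z‖ at hz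
  obtain ⟨ht0, hsum⟩ := ht
  have h0 : eval₂ (evalAt A κ : A →+* ℂ) z α = 0 := hp
  rw [eval₂_eq_sum_range, Finset.sum_range_succ, hα.coeff_natDegree, map_one, one_mul] at h0
  set n := α.natDegree
  have hzp : 0 < ‖z‖ := ht0.trans hz
  have h2 : ‖z‖ ^ n ≤ ∑ k ∈ Finset.range n, ‖α.coeff k‖ * ‖z‖ ^ k := by
    rw [← norm_pow, eq_neg_of_add_eq_zero_right h0, norm_neg]
    refine (norm_sum_le _ _).trans (Finset.sum_le_sum fun i _ => ?_)
    rw [norm_mul, norm_pow]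
    exact mul_le_mul_of_nonneg_right (norm_apply_le _ _) (by positivity)
  -- Passing from `t` to `‖z‖` multiplies the `k`-th term, `k < n`, by at most
  -- `(‖z‖ / t) ^ (n - 1)`.
  have h3 : ∀ k ∈ Finset.range n,
      ‖α.coeff k‖ * ‖z‖ ^ k * t ^ n ≤ ‖α.coeff k‖ * t ^ k * (t * ‖z‖ ^ (n - 1)) := by
    intro k hk
    have hk := Finset.mem_range.mp hk
    obtain ⟨m, hm⟩ : ∃ m, n = k + 1 + m := ⟨n - (k + 1), by lia⟩
    have : n - 1 = k + m := by lia
    rw [this, hm]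
    have hle : t ^ m ≤ ‖z‖ ^ m := pow_le_pow_left₀ ht0.le hz.le m
    calc ‖α.coeff k‖ * ‖z‖ ^ k * t ^ (k + 1 + m)
        = ‖α.coeff k‖ * ‖z‖ ^ k * t ^ (k + 1) * t ^ m := by ring
      _ ≤ ‖α.coeff k‖ * ‖z‖ ^ k * t ^ (k + 1) * ‖z‖ ^ m := by gcongr
      _ = _ := by ring
  rcases Nat.eq_zero_or_pos n with hn | hn
  · rw [hn] at h2
    norm_num at h2
  have h4 : ‖z‖ ^ n * t ^ n ≤ t ^ n * (t * ‖z‖ ^ (n - 1)) := by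
    calc ‖z‖ ^ n * t ^ n ≤ (∑ k ∈ Finset.range n, ‖α.coeff k‖ * ‖z‖ ^ k) * t ^ n := by gcongr
      _ = ∑ k ∈ Finset.range n, ‖α.coeff k‖ * ‖z‖ ^ k * t ^ n := Finset.sum_mul ..
      _ ≤ ∑ k ∈ Finset.range n, ‖α.coeff k‖ * t ^ k * (t * ‖z‖ ^ (n - 1)) :=
        Finset.sum_le_sum h3
      _ = (∑ k ∈ Finset.range n, ‖α.coeff k‖ * t ^ k) * (t * ‖z‖ ^ (n - 1)) :=
        (Finset.sum_mul ..).symm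
      _ ≤ _ := by gcongr
  rw [mul_comm] at h4
  have h5 := le_of_mul_le_mul_left h4 (pow_pos ht0 n)
  rw [← Nat.sub_add_cancel hn, pow_succ', Nat.add_sub_cancel] at h5
  exact absurd (le_of_mul_le_mul_right h5 (pow_pos hzp _)) (not_le.mpr hz)

/-- The characters of `A[x]/(α)` given by the points of `coleSpace α` are contractive for every
Arens–Hoffman norm. -/
theorem norm_rootEval_le_ahNorm (hα : α.Monic) {t : ℝ} (ht : IsAHParameter α t)
    (p : coleSpace α) (b : AdjoinRoot α) : ‖rootEval p b‖ ≤ ahNorm α t b := by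
  refine le_csInf ?_ ?_
  · obtain ⟨g, hg⟩ := AdjoinRoot.mk_surjective b
    exact ⟨_, g, hg, rfl⟩
  · rintro _ ⟨g, hg, rfl⟩
    rw [← show _ = b from hg, rootEval_mk, eval₂_def, polyNorm, Polynomial.sum, Polynomial.sum]
    refine (norm_sum_le _ _).trans (Finset.sum_le_sum fun k _ => ?_)
    rw [norm_mul, norm_pow]
    have h1 : ‖p.1.2‖ ^ k ≤ t ^ k := pow_le_pow_left₀ (norm_nonneg _) (norm_root_le hα ht p) k
    exact mul_le_mul (norm_apply_le (g.coeff k) p.1.1) h1 (by positivity) (norm_nonneg _)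

theorem isAHClosed_ker_rootEval (hα : α.Monic) {t : ℝ} (ht : IsAHParameter α t)
    (p : coleSpace α) : IsAHClosed α t (RingHom.ker (rootEval p) : Set (AdjoinRoot α)) := by
  intro b hb
  change rootEval p b = 0
  refine norm_le_zero_iff.mp (le_of_forall_pos_le_add fun ε hε => ?_)
  obtain ⟨s, hs, h⟩ := hb ε hε
  have hs : rootEval p s = 0 := hs
  have h1 := norm_rootEval_le_ahNorm hα ht p (b - s)
  rw [map_sub, hs, sub_zero] at h1
  linarith

/-- If `discr α` is not a zero divisor, then the radical of the Arens–Hoffman extension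
vanishes. -/
theorem ahRadical_eq_bot [Nonempty X] (hα : α.Monic) (hd : ∀ a : A, a * α.discr = 0 → a = 0)
    {t : ℝ} (ht : IsAHParameter α t) : ahRadical α t = ⊥ := by
  refine eq_bot_iff.mpr fun b hb => ?_
  refine (Submodule.mem_bot _).mpr (eq_zero_of_rootEval_eq_zero hα hd fun p => ?_)
  refine (Submodule.mem_sInf.mp hb) (RingHom.ker (rootEval p))
    ⟨RingHom.ker_isMaximal_of_surjective _ fun z => ⟨algebraMap ℂ _ z, ?_⟩,
      isAHClosed_ker_rootEval hα ht p⟩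
  exact (rootEval p).commutes z

end

/-! ### Automatic continuity -/

section

variable {X : Type*} [TopologicalSpace X] [CompactSpace X] {A : Subalgebra ℂ C(X, ℂ)} {α : A[X]}

/-- An algebra isomorphism of `A[x]/(α)` onto the simple Cole extension forces the supremum norm
over `coleSpace α` to dominate the coordinates.  The inverse isomorphism is continuous by the closed
graph theorem, since the characters `rootEval p` are jointly injective and characters of a Banach
algebra are continuous; and by naturality evaluations on the Cole extension pull back to
characters `rootEval p`, so the isomorphism does not increase the supremum norm. -/
theorem exists_coords_bound [T2Space X] [Nonempty X]
    (hAc : IsClosed (A : Set C(X, ℂ))) (hA : IsNatural A)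
    (hα : α.Monic) (hd : ∀ a : A, a * α.discr = 0 → a = 0)
    (Θ : AdjoinRoot α ≃ₐ[ℂ] coleExtension α) :
    ∃ c : ℝ, 0 < c ∧ ∀ (b : AdjoinRoot α) (M : ℝ), 0 ≤ M → (∀ p, ‖rootEval p b‖ ≤ M) →
      ∀ i, ‖coords hα b i‖ ≤ c * M := by
  have := compactSpace_coleSpace hα
  have : CompleteSpace A := hAc.completeSpace_coe
  have : CompleteSpace (coleExtension α) :=
    (Subalgebra.isClosed_topologicalClosure _).completeSpace_coe
  let T : coleExtension α →ₗ[ℂ] (Fin α.natDegree → A) :=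
    ((coords hα).restrictScalars ℂ).toLinearMap ∘ₗ Θ.symm.toLinearMap
  have hT : ∀ f, T f = coords hα (Θ.symm f) := fun _ => rfl
  have hTc : Continuous T := by
    refine T.continuous_of_seq_closed_graph fun u f y hu hy => ?_
    have hy' : coords hα ((coords hα).symm y) = y := (coords hα).apply_symm_apply y
    rw [hT, ← hy']
    congr 1
    rw [← sub_eq_zero]
    refine eq_zero_of_rootEval_eq_zero hα hd fun p => ?_
    rw [map_sub, sub_eq_zero]
    have h1 : Tendsto (fun k => rootEval p (Θ.symm (u k))) atTop
        (𝓝 (rootEval p (Θ.symm f))) :=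
      ((((rootEval p).comp Θ.symm.toAlgHom).toContinuousLinearMap.continuous).tendsto f).comp hu
    refine tendsto_nhds_unique ?_ h1
    simp only [rootEval_eq_sum hα, hy']
    refine tendsto_finsetSum _ fun i _ => Tendsto.mul_const _ ?_
    have h2 : Continuous fun v : Fin α.natDegree → A => (v i : C(X, ℂ)) p.1.1 :=
      (continuous_eval_const p.1.1).comp
        (continuous_subtype_val.comp (continuous_apply i))
    exact (h2.tendsto y).comp hy
  let T' : coleExtension α →L[ℂ] (Fin α.natDegree → A) := ⟨T, hTc⟩
  obtain ⟨c, hc, hbound⟩ := T'.bound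
  refine ⟨c, hc, fun b M hM hb i => ?_⟩
  have h3 : ‖Θ b‖ ≤ M := by
    refine (ContinuousMap.norm_le (Θ b : C(coleSpace α, ℂ)) hM).mpr fun p => ?_
    obtain ⟨p', hp'⟩ := exists_eq_rootEval hA
      (((ContinuousMap.evalAlgHom ℂ ℂ p).comp (coleExtension α).val).comp Θ.toAlgHom)
    have h4 : (Θ b : C(coleSpace α, ℂ)) p = rootEval p' b := by rw [← hp']; rfl
    rw [h4]
    exact hb p'
  have h5 : coords hα b = T' (Θ b) := by
    change _ = coords hα (Θ.symm (Θ b))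
    rw [AlgEquiv.symm_apply_apply]
  calc ‖coords hα b i‖ ≤ ‖coords hα b‖ := norm_le_pi_norm _ i
    _ ≤ c * ‖Θ b‖ := by rw [h5]; exact hbound _
    _ ≤ c * M := by gcongr

/-! ### Peaking at a zero of a topological divisor of zero -/

/-- A subset of `X` on which every element of `A` attains its norm: a boundary for `A`. -/
def IsMaxModulusSet (A : Subalgebra ℂ C(X, ℂ)) (E : Set X) : Prop :=
  ∀ f : A, ‖f‖ = 1 → ∃ x ∈ E, ‖(f : C(X, ℂ)) x‖ = 1

theorem exists_norm_apply_eq [Nonempty X] (f : A) : ∃ x, ‖(f : C(X, ℂ)) x‖ = ‖f‖ := by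
  obtain ⟨x, -, hx⟩ := isCompact_univ.exists_isMaxOn Set.univ_nonempty
    (f : C(X, ℂ)).continuous.norm.continuousOn
  exact ⟨x, le_antisymm (norm_apply_le f x)
    ((ContinuousMap.norm_le (f : C(X, ℂ)) (norm_nonneg _)).mpr fun y => hx (Set.mem_univ y))⟩

theorem norm_pow_eq_one [Nonempty X] {f : A} (hf : ‖f‖ = 1) (k : ℕ) : ‖f ^ k‖ = 1 := by
  obtain ⟨x, hx⟩ := exists_norm_apply_eq f
  refine le_antisymm ((ContinuousMap.norm_le ((f ^ k : A) : C(X, ℂ)) zero_le_one).mpr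
    fun y => ?_) ?_
  · have := norm_apply_le f y
    rw [hf] at this
    rw [norm_pow_apply]
    exact pow_le_one₀ (norm_nonneg _) this
  · have := norm_apply_le (f ^ k) x
    rwa [norm_pow_apply, hx, hf, one_pow] at this

/-- On a closed set where `‖f‖ < 1`, some power of `f` is arbitrarily small. -/
theorem exists_norm_pow_apply_le {f : A} {E : Set X} (hE : IsClosed E)
    (hf : ∀ x ∈ E, ‖(f : C(X, ℂ)) x‖ < 1) {ε : ℝ} (hε : 0 < ε) :
    ∃ k, ∀ x ∈ E, ‖((f ^ k : A) : C(X, ℂ)) x‖ ≤ ε := by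
  rcases E.eq_empty_or_nonempty with rfl | hne
  · exact ⟨0, fun x hx => hx.elim⟩
  obtain ⟨y, hy, hmax⟩ := hE.isCompact.exists_isMaxOn hne
    ((f : C(X, ℂ)).continuous.norm.continuousOn)
  obtain ⟨k, hk⟩ := exists_pow_lt_of_lt_one hε (hf y hy)
  refine ⟨k, fun x hx => ?_⟩
  have : ‖(f : C(X, ℂ)) x‖ ^ k ≤ ‖(f : C(X, ℂ)) y‖ ^ k :=
    pow_le_pow_left₀ (norm_nonneg _) (hmax hx) k
  rw [norm_pow_apply]
  exact this.trans hk.le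

theorem IsMaxModulusSet.norm_apply_lt {E : Set X} (hE : IsMaxModulusSet A E) {f : A} {η : ℝ}
    (hη : 0 < η) (hf : ∀ x ∈ E, ‖(f : C(X, ℂ)) x‖ < η) (y : X) : ‖(f : C(X, ℂ)) y‖ < η := by
  refine (norm_apply_le f y).trans_lt ?_
  by_contra! h
  have hpos : 0 < ‖f‖ := hη.trans_le h
  obtain ⟨x, hx, h1⟩ := hE (((‖f‖ : ℂ)⁻¹) • f) (by
    rw [norm_smul, norm_inv, Complex.norm_real, norm_norm, inv_mul_cancel₀ hpos.ne'])
  have h2 : ‖(f : C(X, ℂ)) x‖ = ‖f‖ := by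
    have h3 : ‖f‖⁻¹ * ‖(f : C(X, ℂ)) x‖ = 1 := by
      rw [← h1, ← norm_norm f, ← Complex.norm_real, ← norm_inv, Complex.norm_real, norm_norm]
      exact (norm_mul ((‖f‖ : ℂ)⁻¹) ((f : C(X, ℂ)) x)).symm
    field_simp at h3
    exact h3
  linarith [hf x hx]

/-- Hörmander's lemma on boundaries: a neighbourhood defined by finitely many elements of `A` whose
complement is a boundary can be removed from every closed boundary.  If not, some `f` of norm `1`
has modulus `< 1` on `E` off the neighbourhood; then all `f ^ k * (F i - F i κ)`, `k` large, are
smaller than `η` on `E`, hence everywhere, so `‖f‖` is not attained off the neighbourhood. -/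
theorem IsMaxModulusSet.inter {ι : Type*} [Finite ι] (F : ι → A) (κ : X) {η : ℝ} (hη : 0 < η)
    {E : Set X} (hE : IsClosed E) (hEA : IsMaxModulusSet A E)
    (hU : IsMaxModulusSet A {x | ∃ i, η ≤ ‖(F i : C(X, ℂ)) x - (F i : C(X, ℂ)) κ‖}) :
    IsMaxModulusSet A (E ∩ {x | ∃ i, η ≤ ‖(F i : C(X, ℂ)) x - (F i : C(X, ℂ)) κ‖}) := by
  have := Fintype.ofFinite ι
  set V := {x | ∃ i, η ≤ ‖(F i : C(X, ℂ)) x - (F i : C(X, ℂ)) κ‖}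
  have hVc : IsClosed V := isClosed_exists_le_norm_sub F κ η
  intro f hf
  have hfle : ∀ x, ‖(f : C(X, ℂ)) x‖ ≤ 1 := fun x => hf ▸ norm_apply_le f x
  by_contra! hcon
  let G : ι → A := fun i => F i - algebraMap ℂ A ((F i : C(X, ℂ)) κ)
  have hG : ∀ i x, (G i : C(X, ℂ)) x = (F i : C(X, ℂ)) x - (F i : C(X, ℂ)) κ := fun _ _ => rfl
  set K : ℝ := 1 + ∑ i, ‖G i‖ with hK
  have hK0 : 0 < K := by
    have : 0 ≤ ∑ i, ‖G i‖ := Finset.sum_nonneg fun _ _ => norm_nonneg _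
    linarith
  have hGK : ∀ i x, ‖(G i : C(X, ℂ)) x‖ < K := fun i x => by
    have h1 := Finset.single_le_sum (f := fun i => ‖G i‖) (fun _ _ => norm_nonneg _)
      (Finset.mem_univ i)
    linarith [norm_apply_le (G i) x]
  obtain ⟨k, hk⟩ := exists_norm_pow_apply_le (hE.inter hVc)
    (fun x hx => lt_of_le_of_ne (hfle x) (hcon x hx)) (div_pos hη hK0)
  have hsmall : ∀ i y, ‖((f ^ k * G i : A) : C(X, ℂ)) y‖ < η := by
    refine fun i y => hEA.norm_apply_lt hη (fun x hx => ?_) y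
    rw [norm_mul_apply]
    by_cases hxV : x ∈ V
    · calc _ ≤ η / K * ‖(G i : C(X, ℂ)) x‖ := by gcongr; exact hk x ⟨hx, hxV⟩
        _ < η / K * K := mul_lt_mul_of_pos_left (hGK i x) (div_pos hη hK0)
        _ = η := div_mul_cancel₀ _ hK0.ne'
    · have h1 : ‖(G i : C(X, ℂ)) x‖ < η := by
        rw [hG]
        by_contra! h
        exact hxV ⟨i, h⟩
      have h2 : ‖((f ^ k : A) : C(X, ℂ)) x‖ ≤ 1 := by
        rw [norm_pow_apply]
        exact pow_le_one₀ (norm_nonneg _) (hfle x)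
      nlinarith [norm_nonneg ((G i : C(X, ℂ)) x)]
  obtain ⟨x, ⟨i, hi⟩, hx⟩ := hU f hf
  have h3 := hsmall i x
  rw [norm_mul_apply, norm_pow_apply, hx, one_pow, one_mul, hG] at h3
  linarith

/-- If `d` is a topological divisor of zero, then it has a zero `κ` at which `A` peaks as seen by
the finitely many functions `F i`: for all `η, ε` there is an element of norm `1` that is `≤ ε`
off the neighbourhood `{∀ i, ‖F i - F i κ‖ < η}`.  Otherwise finitely many neighbourhoods whose
complements are boundaries cover the zeros of `d`, and their removal leaves a boundary on which
`‖d‖` is bounded below. -/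
theorem exists_peaking_zero [Nonempty X] {ι : Type*} [Finite ι] (F : ι → A) {d : A}
    (hd : IsTopologicalDivisorOfZero d) :
    ∃ κ : X, (d : C(X, ℂ)) κ = 0 ∧ ∀ η > 0, ∀ ε > 0, ∃ f : A, ‖f‖ = 1 ∧
      ∀ x, (∃ i, η ≤ ‖(F i : C(X, ℂ)) x - (F i : C(X, ℂ)) κ‖) → ‖(f : C(X, ℂ)) x‖ ≤ ε := by
  classical
  by_contra! hcon
  have hex : ∀ κ : X, ∃ η : ℝ, 0 < η ∧ ((d : C(X, ℂ)) κ = 0 →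
      IsMaxModulusSet A {x | ∃ i, η ≤ ‖(F i : C(X, ℂ)) x - (F i : C(X, ℂ)) κ‖}) := by
    intro κ
    by_cases hκ : (d : C(X, ℂ)) κ = 0
    · obtain ⟨η, hη, ε, hε, h⟩ := hcon κ hκ
      refine ⟨η, hη, fun _ f hf => ?_⟩
      by_contra! hne
      obtain ⟨k, hk⟩ := exists_norm_pow_apply_le (isClosed_exists_le_norm_sub F κ η)
        (fun x hx => lt_of_le_of_ne (hf ▸ norm_apply_le f x) (hne x hx)) hε
      obtain ⟨x, hx, hlt⟩ := h (f ^ k) (norm_pow_eq_one hf k)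
      exact absurd (hk x hx) (not_le.mpr hlt)
    · exact ⟨1, one_pos, fun h => absurd h hκ⟩
  choose η hη hmax using hex
  set V : X → Set X := fun κ =>
    {x | ∃ i, η κ ≤ ‖(F i : C(X, ℂ)) x - (F i : C(X, ℂ)) κ‖}
  have hZ : IsCompact {x : X | (d : C(X, ℂ)) x = 0} :=
    (isClosed_eq (d : C(X, ℂ)).continuous continuous_const).isCompact
  obtain ⟨s, hsZ, hs⟩ := hZ.elim_nhds_subcover (fun κ => (V κ)ᶜ) fun κ _ =>
    (isClosed_exists_le_norm_sub F κ (η κ)).isOpen_compl.mem_nhds (by simp [hη κ])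
  have hkey : ∀ r : Finset X, (∀ κ ∈ r, (d : C(X, ℂ)) κ = 0) →
      IsClosed {x | ∀ κ ∈ r, x ∈ V κ} ∧ IsMaxModulusSet A {x | ∀ κ ∈ r, x ∈ V κ} := by
    intro r
    induction r using Finset.induction_on with
    | empty =>
      intro _
      refine ⟨by simp, fun f hf => ?_⟩
      obtain ⟨x, hx⟩ := exists_norm_apply_eq f
      exact ⟨x, by simp, hx.trans hf⟩
    | insert κ r _ ih =>
      intro hr
      obtain ⟨h1, h2⟩ := ih fun κ' h => hr κ' (Finset.mem_insert_of_mem h)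
      have hEq : {x | ∀ κ' ∈ insert κ r, x ∈ V κ'} = {x | ∀ κ ∈ r, x ∈ V κ} ∩ V κ := by
        ext x; simp [and_comm]
      rw [hEq]
      exact ⟨h1.inter (isClosed_exists_le_norm_sub F κ _),
        h2.inter F κ (hη κ) h1 (hmax κ (hr κ (Finset.mem_insert_self _ _)))⟩
  obtain ⟨hEc, hEm⟩ := hkey s hsZ
  set E := {x | ∀ κ ∈ s, x ∈ V κ}
  have hne0 : ∀ x ∈ E, (d : C(X, ℂ)) x ≠ 0 := by
    intro x hx h0
    obtain ⟨κ, hκ, hxκ⟩ := Set.mem_iUnion₂.mp (hs h0)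
    exact hxκ (hx κ hκ)
  obtain ⟨u, hu1, hu0⟩ := hd
  have hEne : E.Nonempty := by
    obtain ⟨x, hx, _⟩ := hEm (u 0) (hu1 0)
    exact ⟨x, hx⟩
  obtain ⟨y, hy, hmin⟩ := hEc.isCompact.exists_isMinOn hEne
    ((d : C(X, ℂ)).continuous.norm.continuousOn)
  have hδ : 0 < ‖(d : C(X, ℂ)) y‖ := norm_pos_iff.mpr (hne0 y hy)
  obtain ⟨m, hm⟩ := (((tendsto_zero_iff_norm_tendsto_zero.mp hu0).eventually
    (gt_mem_nhds hδ))).exists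
  obtain ⟨x, hx, hux⟩ := hEm (u m) (hu1 m)
  have h1 := norm_apply_le (u m * d) x
  have h2 : ‖((u m * d : A) : C(X, ℂ)) x‖ = ‖(d : C(X, ℂ)) x‖ := by
    rw [norm_mul_apply, hux, one_mul]
  have h3 : ‖(d : C(X, ℂ)) y‖ ≤ ‖(d : C(X, ℂ)) x‖ := hmin hx
  linarith

/-! ### The Cole–Feinstein conjecture fails over a topological divisor of zero -/

/-- At a peaking zero `κ` of the discriminant take a complex monic polynomial `q` of degree `< n`
vanishing at all roots of `α` over `κ`.  Multiplied by an element of `A` of norm `1` concentrated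
where the coefficients of `α` are close to their values at `κ`, it has a coordinate of norm `1`
and is uniformly small on `coleSpace α`, against `exists_coords_bound`. -/
theorem isEmpty_algEquiv_coleExtension [T2Space X] [Nonempty X]
    (hAc : IsClosed (A : Set C(X, ℂ))) (hA : IsNatural A) (hα : α.Monic)
    (htd : IsTopologicalDivisorOfZero α.discr) (hd : ∀ a : A, a * α.discr = 0 → a = 0)
    {t : ℝ} (ht : IsAHParameter α t) :
    IsEmpty ((AdjoinRoot α ⧸ ahRadical α t) ≃ₐ[ℂ] coleExtension α) := by
  refine ⟨fun Θ₀ => ?_⟩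
  let Θ : AdjoinRoot α ≃ₐ[ℂ] coleExtension α :=
    ((AlgEquiv.quotientBot ℂ (AdjoinRoot α)).symm.trans
      (Ideal.quotientEquivAlgOfEq ℂ (ahRadical_eq_bot hα hd ht).symm)).trans Θ₀
  obtain ⟨c, hc, hbound⟩ := exists_coords_bound hAc hA hα hd Θ
  have := compactSpace_coleSpace hα
  obtain ⟨κ, hκ, hpeak⟩ := exists_peaking_zero (fun i : Fin α.natDegree => α.coeff i) htd
  obtain ⟨q, hqm, hqdeg, hq⟩ := exists_monic_natDegree_lt_of_not_separable
    (hα.map (evalAt A κ : A →+* ℂ))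
    (fun h => (map_discr_ne_zero_iff (evalAt A κ : A →+* ℂ) hα).mpr h hκ)
  rw [hα.natDegree_map] at hqdeg
  set ε : ℝ := 1 / (2 * c) with hε
  have hε0 : 0 < ε := by positivity
  -- A neighbourhood of `κ`, described by the coefficients of `α`, over which `q` is small.
  let m : coleSpace α → ℝ := fun p =>
    ‖fun i : Fin α.natDegree => (α.coeff i : C(X, ℂ)) p.1.1 - (α.coeff i : C(X, ℂ)) κ‖
  have hm : Continuous m := continuous_norm.comp (continuous_pi fun i =>
    ((α.coeff i : C(X, ℂ)).continuous.comp
      (continuous_fst.comp continuous_subtype_val)).sub continuous_const)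
  have hqc : Continuous fun p : coleSpace α => ‖q.eval p.1.2‖ :=
    (q.continuous.comp (continuous_snd.comp continuous_subtype_val)).norm
  have hzero : ∀ p, m p = 0 → q.eval p.1.2 = 0 := by
    intro p hp
    have hp := norm_eq_zero.mp hp
    refine hq _ ((mem_coleSpace_iff κ p.1.2).mp ?_)
    have h0 : eval₂ (evalAt A p.1.1 : A →+* ℂ) p.1.2 α = 0 := p.2
    change eval₂ (evalAt A κ : A →+* ℂ) p.1.2 α = 0
    rw [eval₂_eq_sum_range, Finset.sum_range_succ, hα.coeff_natDegree, map_one] at h0 ⊢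
    rw [← h0]
    congr 1
    refine Finset.sum_congr rfl fun i hi => ?_
    have := congrFun hp ⟨i, Finset.mem_range.mp hi⟩
    congr 1
    exact (sub_eq_zero.mp this).symm
  obtain ⟨η, hη, hηq⟩ : ∃ η > 0, ∀ p, m p < η → ‖q.eval p.1.2‖ ≤ ε := by
    rcases Set.eq_empty_or_nonempty {p : coleSpace α | ε ≤ ‖q.eval p.1.2‖} with h | h
    · refine ⟨1, one_pos, fun p _ => ?_⟩
      by_contra! hlt
      exact (h ▸ hlt.le : p ∈ (∅ : Set (coleSpace α)))
    · obtain ⟨p₀, hp₀, hmin⟩ := (isClosed_le continuous_const hqc).isCompact.exists_isMinOn h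
        hm.continuousOn
      refine ⟨m p₀, (norm_nonneg _).lt_of_ne fun h0 => ?_, fun p hp => ?_⟩
      · have hp₀ : ε ≤ ‖q.eval p₀.1.2‖ := hp₀
        rw [hzero p₀ h0.symm, norm_zero] at hp₀
        linarith
      · by_contra! hlt
        exact absurd (hmin (show p ∈ {p : coleSpace α | ε ≤ ‖q.eval p.1.2‖} from hlt.le))
          (not_le.mpr hp)
  obtain ⟨K, hK⟩ := (isCompact_univ (X := coleSpace α)).bddAbove_image hqc.continuousOn
  have hK : ∀ p : coleSpace α, ‖q.eval p.1.2‖ ≤ K := fun p => hK ⟨p, trivial, rfl⟩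
  obtain ⟨f, hf1, hf⟩ := hpeak η hη (ε / (|K| + 1)) (by positivity)
  have hsmall : ∀ p, ‖rootEval p (AdjoinRoot.mk α (C f * q.map (algebraMap ℂ A)))‖ ≤ ε := by
    intro p
    have hcomp : (evalAt A p.1.1 : A →+* ℂ).comp (algebraMap ℂ A) = RingHom.id ℂ :=
      RingHom.ext fun z => (evalAt A p.1.1).commutes z
    have h1 : rootEval p (AdjoinRoot.mk α (C f * q.map (algebraMap ℂ A))) =
        (f : C(X, ℂ)) p.1.1 * q.eval p.1.2 := by
      rw [rootEval_mk, eval₂_mul, eval₂_C, eval₂_map, hcomp, eval₂_id]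
      rfl
    rw [h1, norm_mul]
    have hf2 := norm_apply_le f p.1.1
    rw [hf1] at hf2
    by_cases hp : m p < η
    · calc _ ≤ 1 * ε := by gcongr; exact hηq p hp
        _ = ε := one_mul _
    · have hp' : ∃ i : Fin α.natDegree,
          η ≤ ‖(α.coeff i : C(X, ℂ)) p.1.1 - (α.coeff i : C(X, ℂ)) κ‖ := by
        by_contra! h
        exact hp ((pi_norm_lt_iff hη).mpr h)
      calc _ ≤ ε / (|K| + 1) * (|K| + 1) := by
            gcongr
            · exact hf _ hp'
            · linarith [hK p, le_abs_self K]
        _ = ε := div_mul_cancel₀ _ (by positivity)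
  have hdeg : (C f * q.map (algebraMap ℂ A)).natDegree < α.natDegree :=
    (natDegree_C_mul_le _ _).trans_lt (natDegree_map_le.trans_lt hqdeg)
  have h2 := hbound _ ε hε0.le hsmall ⟨q.natDegree, hqdeg⟩
  rw [coords_mk hα hdeg, coeff_C_mul, coeff_map, hqm.coeff_natDegree, map_one, mul_one, hf1,
    hε] at h2
  have h3 : c * (1 / (2 * c)) = 1 / 2 := by field_simp
  rw [h3] at h2
  norm_num at h2

end

/-! ### The disc algebra -/

theorem discAlgebra_isClosed : IsClosed (discAlgebra : Set C(ClosedDisc, ℂ)) := by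
  classical
  let ext : C(ClosedDisc, ℂ) → ℂ → ℂ := fun f z =>
    if h : z ∈ Metric.closedBall (0 : ℂ) 1 then f ⟨z, h⟩ else 0
  refine isSeqClosed_iff_isClosed.mp fun u f hu hf => ?_
  have hext : ∀ (h : C(ClosedDisc, ℂ)) (z : ℂ) (hz : z ∈ Metric.closedBall (0 : ℂ) 1),
      ext h z = h ⟨z, hz⟩ := fun h z hz => dif_pos hz
  refine ⟨ext f, ?_, fun z _ => (hext f z z.2).symm⟩
  have hunif : TendstoUniformlyOn (fun n => ext (u n)) (ext f) atTop (Metric.ball (0 : ℂ) 1) := by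
    rw [Metric.tendstoUniformlyOn_iff]
    intro ε hε
    filter_upwards [Metric.tendsto_nhds.mp hf ε hε] with n hn z hz
    rw [hext _ z (Metric.ball_subset_closedBall hz), hext _ z (Metric.ball_subset_closedBall hz),
      dist_comm]
    exact (ContinuousMap.dist_apply_le_dist _).trans_lt hn
  refine hunif.tendstoLocallyUniformlyOn.differentiableOn (Eventually.of_forall fun n => ?_)
    Metric.isOpen_ball
  obtain ⟨g, hg, hug⟩ := hu n
  refine hg.congr fun z hz => ?_
  rw [hext _ z (Metric.ball_subset_closedBall hz)]
  exact hug ⟨z, _⟩ hz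

theorem isUniformAlgebra_discAlgebra : IsUniformAlgebra discAlgebra where
  separatesPoints := fun _ _ hzw =>
    ⟨_, ⟨(discCoord : C(ClosedDisc, ℂ)), discCoord.2, rfl⟩, fun h => hzw (Subtype.ext h)⟩
  isClosed := discAlgebra_isClosed

instance : Nonempty ClosedDisc := ⟨⟨0, by simp⟩⟩

instance : CompleteSpace discAlgebra := discAlgebra_isClosed.completeSpace_coe

/-- A function holomorphic in a neighbourhood of the closed disc, as an element of the disc
algebra. -/
def discOfDifferentiableOn (g : ℂ → ℂ) {R : ℝ} (hR : 1 < R)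
    (hg : DifferentiableOn ℂ g (Metric.ball 0 R)) : discAlgebra :=
  ⟨⟨fun z => g z, hg.continuousOn.comp_continuous continuous_subtype_val
      fun z => Metric.closedBall_subset_ball hR z.2⟩,
    g, hg.mono (Metric.ball_subset_ball hR.le), fun _ _ => rfl⟩

/-- A character of the disc algebra acts on a function `g` holomorphic in a neighbourhood of the
closed disc as evaluation at its value `w` on the coordinate function: `g - g w` is the product of
`z - w` and the slope of `g` at `w`, which is again holomorphic there. -/
theorem character_discOfDifferentiableOn (φ : discAlgebra →ₐ[ℂ] ℂ) (hw : ‖φ discCoord‖ ≤ 1)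
    (g : ℂ → ℂ) {R : ℝ} (hR : 1 < R) (hg : DifferentiableOn ℂ g (Metric.ball 0 R)) :
    φ (discOfDifferentiableOn g hR hg) = g (φ discCoord) := by
  set w := φ discCoord with hwdef
  have hwR : Metric.ball (0 : ℂ) R ∈ 𝓝 w :=
    Metric.isOpen_ball.mem_nhds (by rw [mem_ball_zero_iff]; linarith)
  have hds := (Complex.differentiableOn_dslope hwR).mpr hg
  have h : discOfDifferentiableOn g hR hg =
      algebraMap ℂ discAlgebra (g w) +
        (discCoord - algebraMap ℂ discAlgebra w) * discOfDifferentiableOn _ hR hds := by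
    refine Subtype.ext (ContinuousMap.ext fun z => ?_)
    change g z = g w + ((z : ℂ) - w) * dslope g w z
    have := sub_smul_dslope g w z
    rw [smul_eq_mul] at this
    rw [this]
    ring
  have hφ : ∀ c : ℂ, φ (algebraMap ℂ discAlgebra c) = c := φ.commutes
  rw [h, map_add, map_mul, map_sub, hφ, hφ, ← hwdef, sub_self, zero_mul, add_zero]

theorem norm_discCoord_le : ‖discCoord‖ ≤ 1 :=
  (ContinuousMap.norm_le (discCoord : C(ClosedDisc, ℂ)) zero_le_one).mpr fun z =>
    mem_closedBall_zero_iff.mp z.2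

/-- The disc algebra is natural: characters are known on the dilates `z ↦ f (r z)`, `r < 1`, which
converge uniformly to `f` as `r → 1`. -/
theorem isNatural_discAlgebra : IsNatural discAlgebra := by
  intro φ
  have hφc : Continuous φ := φ.toContinuousLinearMap.continuous
  have : NormOneClass discAlgebra := ⟨norm_one (α := C(ClosedDisc, ℂ))⟩
  have hw : ‖φ discCoord‖ ≤ 1 :=
    (AlgHom.norm_apply_le_self φ discCoord).trans norm_discCoord_le
  have hwmem : φ discCoord ∈ Metric.closedBall (0 : ℂ) 1 := mem_closedBall_zero_iff.mpr hw
  refine ⟨⟨φ discCoord, hwmem⟩, AlgHom.ext fun f => ?_⟩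
  obtain ⟨g, hg, hfg⟩ := f.2
  let r : ℕ → ℝ := fun n => 1 - 1 / ((n : ℝ) + 2)
  have hr0 : ∀ n, 0 < r n := fun n => by
    have : 1 / ((n : ℝ) + 2) < 1 := by
      rw [div_lt_one (by positivity)]
      linarith [n.cast_nonneg (α := ℝ)]
    simp only [r]; linarith
  have hr1 : ∀ n, r n < 1 := fun n => by
    have : 0 < 1 / ((n : ℝ) + 2) := by positivity
    simp only [r]; linarith
  have hrt : Tendsto r atTop (𝓝 1) := by
    have h1 : Tendsto (fun n : ℕ => (n : ℝ) + 2) atTop atTop :=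
      tendsto_atTop_add_const_right _ _ tendsto_natCast_atTop_atTop
    have := (tendsto_const_nhds (x := (1 : ℝ))).sub (h1.const_div_atTop 1)
    simpa [r] using this
  have hR : ∀ n, 1 < (r n)⁻¹ := fun n => (one_lt_inv₀ (hr0 n)).mpr (hr1 n)
  have hmem : ∀ n (z : ℂ), z ∈ Metric.ball (0 : ℂ) (r n)⁻¹ →
      (r n : ℂ) * z ∈ Metric.ball (0 : ℂ) 1 := by
    intro n z hz
    rw [mem_ball_zero_iff] at hz ⊢
    rw [norm_mul, Complex.norm_real, Real.norm_of_nonneg (hr0 n).le]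
    calc r n * ‖z‖ < r n * (r n)⁻¹ := mul_lt_mul_of_pos_left hz (hr0 n)
      _ = 1 := mul_inv_cancel₀ (hr0 n).ne'
  have hdiff : ∀ n, DifferentiableOn ℂ (fun z => g ((r n : ℂ) * z))
      (Metric.ball 0 (r n)⁻¹) := fun n =>
    hg.comp (by fun_prop) fun z hz => hmem n z hz
  let F : ℕ → discAlgebra := fun n => discOfDifferentiableOn _ (hR n) (hdiff n)
  have hball : ∀ n (z : ClosedDisc), (r n : ℂ) * z ∈ Metric.ball (0 : ℂ) 1 := fun n z =>
    hmem n z (Metric.closedBall_subset_ball (hR n) z.2)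
  have hFapply : ∀ n (z : ClosedDisc), (F n : C(ClosedDisc, ℂ)) z =
      (f : C(ClosedDisc, ℂ)) ⟨(r n : ℂ) * z, Metric.ball_subset_closedBall (hball n z)⟩ :=
    fun n z => (hfg ⟨_, Metric.ball_subset_closedBall (hball n z)⟩ (hball n z)).symm
  have hF : Tendsto F atTop (𝓝 f) := by
    have huc : UniformContinuous (f : C(ClosedDisc, ℂ)) :=
      CompactSpace.uniformContinuous_of_continuous (f : C(ClosedDisc, ℂ)).continuous
    rw [Metric.tendsto_nhds]
    intro ε hε
    obtain ⟨δ, hδ, h⟩ := Metric.uniformContinuous_iff.mp huc (ε / 2) (by positivity)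
    filter_upwards [Metric.tendsto_nhds.mp hrt δ hδ] with n hn
    refine lt_of_le_of_lt ?_ (half_lt_self hε)
    refine (ContinuousMap.dist_le (f := (F n : C(ClosedDisc, ℂ))) (by positivity)).mpr
      fun z => ?_
    rw [hFapply]
    refine (h ?_).le
    change dist ((r n : ℂ) * z) z < δ
    have hz : ‖(z : ℂ)‖ ≤ 1 := mem_closedBall_zero_iff.mp z.2
    have : (r n : ℂ) * z - z = ((r n - 1 : ℝ) : ℂ) * z := by push_cast; ring
    rw [dist_eq_norm, this, norm_mul, Complex.norm_real]
    rw [dist_eq_norm] at hn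
    nlinarith [norm_nonneg (r n - 1), norm_nonneg (z : ℂ)]
  have h1 : Tendsto (fun n => φ (F n)) atTop (𝓝 (φ f)) := (hφc.tendsto f).comp hF
  have h2 : Tendsto (fun n => evalAt discAlgebra ⟨φ discCoord, hwmem⟩ (F n)) atTop
      (𝓝 (evalAt discAlgebra ⟨φ discCoord, hwmem⟩ f)) :=
    ((AlgHom.toContinuousLinearMap (evalAt discAlgebra ⟨φ discCoord, hwmem⟩)).continuous.tendsto
      f).comp hF
  refine tendsto_nhds_unique h2 (h1.congr fun n => ?_)
  exact character_discOfDifferentiableOn φ hw _ (hR n) (hdiff n)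

/-! ### The polynomial `x² - (z - 1)` over the disc algebra -/

instance : Nontrivial discAlgebra :=
  ⟨0, 1, fun h => zero_ne_one (α := ℂ)
    (congrArg (fun f : discAlgebra => (f : C(ClosedDisc, ℂ)) ⟨0, by simp⟩) h)⟩

theorem monic_discPoly : discPoly.Monic := monic_X_pow_sub_C _ two_ne_zero

theorem discr_discPoly : discPoly.discr = 4 * (discCoord - 1) := by
  have hdeg : discPoly.degree = 2 := degree_X_pow_sub_C two_pos _
  rw [discr_of_degree_eq_two hdeg]
  simp [discPoly, coeff_C, coeff_one]
  ring

theorem discr_discPoly_apply (z : ClosedDisc) :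
    (discPoly.discr : C(ClosedDisc, ℂ)) z = 4 * ((z : ℂ) - 1) := by
  rw [discr_discPoly]; rfl

/-- The functions `((1 + z) / 2) ^ m` have norm `1` and are concentrated near `z = 1`. -/
theorem isTopologicalDivisorOfZero_discr_discPoly :
    IsTopologicalDivisorOfZero discPoly.discr := by
  let v : discAlgebra := (2⁻¹ : ℂ) • (1 + discCoord)
  have hvm : ∀ m (z : ClosedDisc), ((v ^ m : discAlgebra) : C(ClosedDisc, ℂ)) z =
      (2⁻¹ * (1 + (z : ℂ))) ^ m := fun m z => rfl
  -- The parallelogram law in the disc: `|(1 + z) / 2|² + |(1 - z) / 2|² ≤ 1`.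
  have hpar : ∀ z : ClosedDisc,
      ‖2⁻¹ * (1 + (z : ℂ))‖ ^ 2 + (‖(z : ℂ) - 1‖ / 2) ^ 2 ≤ 1 := by
    intro z
    have hz : ‖(z : ℂ)‖ ≤ 1 := mem_closedBall_zero_iff.mp z.2
    have h1 := parallelogram_law_with_norm ℝ (z : ℂ) 1
    have h2 : ‖2⁻¹ * (1 + (z : ℂ))‖ = ‖(z : ℂ) + 1‖ / 2 := by
      rw [norm_mul, norm_inv, RCLike.norm_ofNat, add_comm]; ring
    rw [h2]
    rw [norm_one] at h1
    nlinarith [norm_nonneg (z : ℂ)]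
  have hone : (1 : ℂ) ∈ Metric.closedBall (0 : ℂ) 1 := by simp
  refine ⟨fun m => v ^ m, fun m => le_antisymm ?_ ?_, ?_⟩
  · refine (ContinuousMap.norm_le ((v ^ m : discAlgebra) : C(ClosedDisc, ℂ)) zero_le_one).mpr
      fun z => ?_
    rw [hvm, norm_pow]
    exact pow_le_one₀ (norm_nonneg _) (by
      nlinarith [hpar z, norm_nonneg (2⁻¹ * (1 + (z : ℂ))), sq_nonneg (‖(z : ℂ) - 1‖ / 2)])
  · have h := ContinuousMap.norm_coe_le_norm ((v ^ m : discAlgebra) : C(ClosedDisc, ℂ)) ⟨1, hone⟩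
    rw [hvm] at h
    norm_num at h
    exact h
  · have hbound : ∀ m : ℕ, ‖v ^ m * discPoly.discr‖ ≤ √(64 / ((m : ℝ) + 1)) := by
      intro m
      refine (ContinuousMap.norm_le ((v ^ m * discPoly.discr : discAlgebra) : C(ClosedDisc, ℂ))
        (Real.sqrt_nonneg _)).mpr fun z => ?_
      refine Real.le_sqrt_of_sq_le ?_
      have hmul : ((v ^ m * discPoly.discr : discAlgebra) : C(ClosedDisc, ℂ)) z =
          ((v ^ m : discAlgebra) : C(ClosedDisc, ℂ)) z *
            (discPoly.discr : C(ClosedDisc, ℂ)) z := rfl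
      rw [hmul, hvm, discr_discPoly_apply, norm_mul, norm_pow, norm_mul (4 : ℂ),
        RCLike.norm_ofNat]
      set a := ‖2⁻¹ * (1 + (z : ℂ))‖ with ha
      set s := ‖(z : ℂ) - 1‖ / 2 with hs
      have hp : a ^ 2 + s ^ 2 ≤ 1 := hpar z
      have ha0 : 0 ≤ a := norm_nonneg _
      -- `a² ≤ 1 - s²`, so Bernoulli's inequality gives `a²ᵐ (1 + m s²) ≤ ((1 - s²) (1 + s²))ᵐ ≤ 1`.
      have hs1 : ‖(z : ℂ) - 1‖ = 2 * s := by rw [hs]; ring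
      have h1 : (a ^ 2) ^ m * (1 + m * s ^ 2) ≤ 1 := by
        have hb : 1 + (m : ℝ) * s ^ 2 ≤ (1 + s ^ 2) ^ m :=
          one_add_mul_le_pow (by nlinarith [sq_nonneg s]) m
        calc (a ^ 2) ^ m * (1 + m * s ^ 2) ≤ (a ^ 2) ^ m * (1 + s ^ 2) ^ m := by gcongr
          _ = (a ^ 2 * (1 + s ^ 2)) ^ m := (mul_pow _ _ _).symm
          _ ≤ 1 := pow_le_one₀ (by positivity) (by nlinarith [sq_nonneg s, sq_nonneg a])
      have h2 : s ^ 2 ≤ 1 := by nlinarith [sq_nonneg a]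
      rw [hs1, le_div_iff₀ (by positivity)]
      have h3 : 0 ≤ (a ^ 2) ^ m := by positivity
      calc (a ^ m * (4 * (2 * s))) ^ 2 * ((m : ℝ) + 1)
          = 64 * ((a ^ 2) ^ m * (s ^ 2 + m * s ^ 2)) := by ring
        _ ≤ 64 * ((a ^ 2) ^ m * (1 + m * s ^ 2)) := by gcongr
        _ ≤ 64 := by linarith
    rw [tendsto_zero_iff_norm_tendsto_zero]
    refine squeeze_zero (fun _ => norm_nonneg _) hbound ?_
    have h1 : Tendsto (fun m : ℕ => (m : ℝ) + 1) atTop atTop :=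
      tendsto_atTop_add_const_right _ _ tendsto_natCast_atTop_atTop
    have := (Real.continuous_sqrt.tendsto 0).comp (h1.const_div_atTop 64)
    rwa [Real.sqrt_zero] at this

/-- An element killed by `z - 1` vanishes on the open disc, hence on its closure. -/
theorem eq_zero_of_mul_discr_discPoly (a : discAlgebra) (ha : a * discPoly.discr = 0) :
    a = 0 := by
  have hoff : ∀ z : ClosedDisc, (z : ℂ) ≠ 1 → (a : C(ClosedDisc, ℂ)) z = 0 := by
    intro z hz
    have h : (a : C(ClosedDisc, ℂ)) z * (discPoly.discr : C(ClosedDisc, ℂ)) z = 0 :=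
      congrArg (fun f : discAlgebra => (f : C(ClosedDisc, ℂ)) z) ha
    rw [discr_discPoly_apply] at h
    exact (mul_eq_zero.mp h).resolve_right (mul_ne_zero (by norm_num) (sub_ne_zero.mpr hz))
  refine Subtype.ext (ContinuousMap.ext fun z => ?_)
  change (a : C(ClosedDisc, ℂ)) z = 0
  let path : ℝ → ClosedDisc := fun r =>
    ⟨((Set.projIcc (0 : ℝ) 1 zero_le_one r : ℝ) : ℂ) * z, by
      have hz : ‖(z : ℂ)‖ ≤ 1 := mem_closedBall_zero_iff.mp z.2
      have hr := (Set.projIcc (0 : ℝ) 1 zero_le_one r).2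
      rw [mem_closedBall_zero_iff, norm_mul, Complex.norm_real, Real.norm_of_nonneg hr.1]
      exact mul_le_one₀ hr.2 (norm_nonneg _) hz⟩
  have hpc : Continuous path := by
    refine Continuous.subtype_mk ?_ _
    exact (Complex.continuous_ofReal.comp
      (continuous_subtype_val.comp continuous_projIcc)).mul continuous_const
  have hp1 : path 1 = z := Subtype.ext (by simp [path])
  have hlim : Tendsto (fun r => (a : C(ClosedDisc, ℂ)) (path r)) (𝓝[<] 1)
      (𝓝 ((a : C(ClosedDisc, ℂ)) (path 1))) :=
    (((a : C(ClosedDisc, ℂ)).continuous.comp hpc).tendsto 1).mono_left nhdsWithin_le_nhds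
  rw [hp1] at hlim
  refine tendsto_nhds_unique hlim (tendsto_const_nhds.congr' ?_)
  filter_upwards [Ioo_mem_nhdsLT (zero_lt_one (α := ℝ))] with r hr
  refine (hoff _ fun h => ?_).symm
  have hval : ((path r : ClosedDisc) : ℂ) = (r : ℂ) * z := by
    simp only [path, Set.projIcc_of_mem zero_le_one ⟨hr.1.le, hr.2.le⟩]
  have hn := congrArg norm (hval.symm.trans h)
  rw [norm_mul, Complex.norm_real, Real.norm_of_nonneg hr.1.le, norm_one] at hn
  have hz : ‖(z : ℂ)‖ ≤ 1 := mem_closedBall_zero_iff.mp z.2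
  nlinarith [hr.1, hr.2, norm_nonneg (z : ℂ)]

theorem discr_discPoly_ne_zero : discPoly.discr ≠ 0 := fun h =>
  one_ne_zero (eq_zero_of_mul_discr_discPoly 1 (by rw [h, mul_zero]))

theorem isAHParameter_discPoly : IsAHParameter discPoly 2 := by
  have hdeg : discPoly.natDegree = 2 := natDegree_X_pow_sub_C
  refine ⟨two_pos, ?_⟩
  have h0 : discPoly.coeff 0 = -(discCoord - 1) := by simp [discPoly, coeff_one]
  have h1 : discPoly.coeff 1 = 0 := by simp [discPoly, coeff_one]
  have hn : ‖discCoord - 1‖ ≤ 1 + 1 :=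
    (norm_sub_le _ _).trans (add_le_add norm_discCoord_le (norm_one (α := C(ClosedDisc, ℂ))).le)
  rw [hdeg, Finset.sum_range_succ, Finset.sum_range_one, h0, h1, norm_neg, norm_zero]
  linarith

end ColeExt

end

theorem theorem4p14 :
    (∀ (X : Type*) [TopologicalSpace X] [CompactSpace X] [T2Space X] [Nonempty X]
      (A : Subalgebra ℂ C(X, ℂ)),
      ColeExt.IsUniformAlgebra A → ColeExt.IsNatural A →
      ∀ α : Polynomial A, α.Monic →
      ColeExt.IsTopologicalDivisorOfZero α.discr →
      α.discr ≠ 0 → (∀ a : A, a * α.discr = 0 → a = 0) →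
      ∀ t : ℝ, ColeExt.IsAHParameter α t →
        IsEmpty ((AdjoinRoot α ⧸ ColeExt.ahRadical α t) ≃ₐ[ℂ] ColeExt.coleExtension α)) ∧
    (ColeExt.IsUniformAlgebra ColeExt.discAlgebra ∧ ColeExt.IsNatural ColeExt.discAlgebra ∧
      ColeExt.discPoly.Monic ∧
      ColeExt.discPoly.discr = 4 * (ColeExt.discCoord - 1) ∧
      ColeExt.IsTopologicalDivisorOfZero ColeExt.discPoly.discr ∧
      ColeExt.discPoly.discr ≠ 0 ∧
      (∀ a : ColeExt.discAlgebra, a * ColeExt.discPoly.discr = 0 → a = 0) ∧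
      (∃ t : ℝ, ColeExt.IsAHParameter ColeExt.discPoly t) ∧
      ∀ t : ℝ, ColeExt.IsAHParameter ColeExt.discPoly t →
        IsEmpty ((AdjoinRoot ColeExt.discPoly ⧸ ColeExt.ahRadical ColeExt.discPoly t) ≃ₐ[ℂ]
          ColeExt.coleExtension ColeExt.discPoly)) := by
  refine ⟨fun X _ _ _ _ A hA hnat α hα htd _ hd t ht =>
    ColeExt.isEmpty_algEquiv_coleExtension hA.isClosed hnat hα htd hd ht, ?_⟩
  exact ⟨ColeExt.isUniformAlgebra_discAlgebra, ColeExt.isNatural_discAlgebra,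
    ColeExt.monic_discPoly, ColeExt.discr_discPoly,
    ColeExt.isTopologicalDivisorOfZero_discr_discPoly, ColeExt.discr_discPoly_ne_zero,
    ColeExt.eq_zero_of_mul_discr_discPoly, ⟨2, ColeExt.isAHParameter_discPoly⟩, fun t ht =>
      ColeExt.isEmpty_algEquiv_coleExtension ColeExt.discAlgebra_isClosed
        ColeExt.isNatural_discAlgebra ColeExt.monic_discPoly
        ColeExt.isTopologicalDivisorOfZero_discr_discPoly ColeExt.eq_zero_of_mul_discr_discPoly
        ht⟩
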